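/- Let $n\ge 3$ be an integer. Let $\mathcal T$ be the regular rooted $n$-ary tree, whose vertices are the finite words over the alphabet $\{1,\dots,n\}$, with root the empty word and with each word $u$ joined to the words $ux$ for $x\in\{1,\dots,n\}$. For $1\le i\le n$ let $\sigma_i=(1,2,\dots,i-1,i+1,\dots,n)$, the cycle of length $n-1$ in the symmetric group $S_n$ that fixes $i$, and let $a_i$ be the automorphism of $\mathcal T$ defined recursively by \[a_i=(1,\dots,1,a_i,1,\dots,1)\,\sigma_i,\] with $a_i$ in the $i$-th coordinate; that is, $a_i$ fixes the empty word, and for a letter $x$ and a word $w$ it sends $xw$ to $\sigma_i(x)\,w$ if $x\ne i$, and $iw$ to $i\,a_i(w)$. Let $G_n$ be the subgroup of $\mathrm{Aut}(\mathcal T)$ generated by $a_1,\dots,a_n$. A group is called just infinite if it is infinite and each of its quotients by a nontrivial normal subgroup is finite. Then $G_n$ is just infinite if and only if $n\ne 3$. -/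

import Mathlib

/-- The regular rooted tree over the alphabet `Fin n`: the vertices are the finite words, the root is
the empty word, and every word `u` is joined to the words `u x` with `x` a letter. -/
def rootedTree (n : ℕ) : SimpleGraph (List (Fin n)) where
  Adj u v := (∃ x, v = u ++ [x]) ∨ (∃ x, u = v ++ [x])
  symm := ⟨fun _ _ h => h.symm⟩
  loopless := ⟨by
    rintro u (⟨x, h⟩ | ⟨x, h⟩) <;> simpa using congrArg List.length h⟩

/-- The automorphisms of the rooted tree: bijections on the vertices which fix the root and preserve
edge incidences. -/
def treeAut (n : ℕ) : Subgroup (Equiv.Perm (List (Fin n))) where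
  carrier := {g | g [] = [] ∧
    ∀ u v, (rootedTree n).Adj (g u) (g v) ↔ (rootedTree n).Adj u v}
  one_mem' := ⟨rfl, fun _ _ => Iff.rfl⟩
  mul_mem' := by
    rintro g h ⟨hg, hg'⟩ ⟨hh, hh'⟩
    refine ⟨by simp [hg, hh], fun u v => ?_⟩
    simp only [Equiv.Perm.mul_apply]
    rw [hg', hh']
  inv_mem' := by
    rintro g ⟨hg, hg'⟩
    refine ⟨by rw [Equiv.Perm.inv_eq_iff_eq, hg], fun u v => ?_⟩
    rw [← hg']
    simp

/-- The cycle `(1, 2, …, i - 1, i + 1, …, n)`, which fixes `i` (letters are numbered from `0` here). -/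
def sigmaPerm {n : ℕ} (i : Fin n) : Equiv.Perm (Fin n) :=
  ((List.finRange n).filter (fun x => x ≠ i)).formPerm

theorem sigmaPerm_self {n : ℕ} (i : Fin n) : sigmaPerm i i = i :=
  List.formPerm_apply_of_notMem (by simp)

/-- The map on words given recursively by `a_i = (1, …, 1, a_i, 1, …, 1) σ_i`, with `a_i` in the
`i`-th coordinate: the first letter is moved by `σ_i`, and the rest of the word is acted on by `a_i`
when the first letter is `i` and is unchanged otherwise. -/
def genFun {n : ℕ} (i : Fin n) : List (Fin n) → List (Fin n)
  | [] => []
  | x :: w => sigmaPerm i x :: (if x = i then genFun i w else w)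

/-- The inverse of `genFun i`. -/
def genInvFun {n : ℕ} (i : Fin n) : List (Fin n) → List (Fin n)
  | [] => []
  | x :: w => (sigmaPerm i).symm x :: (if x = i then genInvFun i w else w)

theorem sigmaPerm_eq_iff {n : ℕ} (i x : Fin n) : sigmaPerm i x = i ↔ x = i := by
  conv_lhs => rhs; rw [← sigmaPerm_self i]
  exact (sigmaPerm i).injective.eq_iff

theorem sigmaPerm_symm_eq_iff {n : ℕ} (i x : Fin n) : (sigmaPerm i).symm x = i ↔ x = i := by
  rw [Equiv.symm_apply_eq, sigmaPerm_self]

theorem genInvFun_genFun {n : ℕ} (i : Fin n) (w : List (Fin n)) :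
    genInvFun i (genFun i w) = w := by
  induction w with
  | nil => rfl
  | cons x w ih =>
    by_cases h : x = i <;> simp [genFun, genInvFun, sigmaPerm_eq_iff, h, ih]

theorem genFun_genInvFun {n : ℕ} (i : Fin n) (w : List (Fin n)) :
    genFun i (genInvFun i w) = w := by
  induction w with
  | nil => rfl
  | cons x w ih =>
    by_cases h : x = i <;> simp [genFun, genInvFun, sigmaPerm_symm_eq_iff, h, ih]

/-- The bijection of the set of words given by `genFun i`. -/
def genPerm {n : ℕ} (i : Fin n) : Equiv.Perm (List (Fin n)) where
  toFun := genFun i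
  invFun := genInvFun i
  left_inv := genInvFun_genFun i
  right_inv := genFun_genInvFun i

theorem genFun_concat {n : ℕ} (i : Fin n) (u : List (Fin n)) (x : Fin n) :
    ∃ y, genFun i (u ++ [x]) = genFun i u ++ [y] := by
  induction u with
  | nil => exact ⟨sigmaPerm i x, by simp [genFun]⟩
  | cons z u ih =>
    obtain ⟨y, hy⟩ := ih
    by_cases h : z = i
    · exact ⟨y, by simp [genFun, h, hy]⟩
    · exact ⟨x, by simp [genFun, h]⟩

theorem genInvFun_concat {n : ℕ} (i : Fin n) (u : List (Fin n)) (x : Fin n) :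
    ∃ y, genInvFun i (u ++ [x]) = genInvFun i u ++ [y] := by
  induction u with
  | nil => exact ⟨(sigmaPerm i).symm x, by simp [genInvFun]⟩
  | cons z u ih =>
    obtain ⟨y, hy⟩ := ih
    by_cases h : z = i
    · exact ⟨y, by simp [genInvFun, h, hy]⟩
    · exact ⟨x, by simp [genInvFun, h]⟩

theorem genPerm_mem_treeAut {n : ℕ} (i : Fin n) : genPerm i ∈ treeAut n := by
  refine ⟨rfl, fun u v => ⟨?_, ?_⟩⟩
  · have key : ∀ u v x, genFun i v = genFun i u ++ [x] → ∃ y, v = u ++ [y] := by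
      intro u v x h
      obtain ⟨y, hy⟩ := genInvFun_concat i (genFun i u) x
      refine ⟨y, ?_⟩
      rw [← h, genInvFun_genFun, genInvFun_genFun] at hy
      exact hy
    rintro (⟨x, h⟩ | ⟨x, h⟩)
    · exact Or.inl (key u v x h)
    · exact Or.inr (key v u x h)
  · rintro (⟨x, rfl⟩ | ⟨x, rfl⟩)
    · exact Or.inl (genFun_concat i u x)
    · exact Or.inr (genFun_concat i v x)

/-- The tree automorphism `a_i = (1, …, 1, a_i, 1, …, 1) σ_i`. -/
def treeGen {n : ℕ} (i : Fin n) : treeAut n :=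
  ⟨genPerm i, genPerm_mem_treeAut i⟩

/-- The group `G_n`, generated by the tree automorphisms `a_1, …, a_n`. -/
def hanoiGroup (n : ℕ) : Subgroup (treeAut n) :=
  Subgroup.closure (Set.range (treeGen (n := n)))

/-- A group is just infinite if it is infinite but each of its proper quotients, that is, each quotient
by a nontrivial normal subgroup, is finite. -/
def IsJustInfinite (G : Type*) [Group G] : Prop :=
  Infinite G ∧ ∀ N : Subgroup G, N.Normal → N ≠ ⊥ → Finite (G ⧸ N)

/-! For n = 3 the generators act on ℤ through the reflections m ↦ -m and m ↦ 1 - m and the identity.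
A signed sum of section actions (`reflWord_apply`) shows, by induction on word length, that every
relation of the group holds for this action. This gives a map onto an infinite dihedral group that
kills `genPerm 2`: an infinite proper quotient.

For n ≥ 4 the group G is regular branch. Any element of G occurs as the section at p of an element
that fixes the first level and has trivial section at a prescribed q ≠ p
(`exists_fixesLetters_hasSection_one`). A commutator is trivial wherever one of its factors is, so n
- 1 nested commutators leave a single nontrivial section. Hence K = γ_{n-1} (with γ_0 = G) contains
a copy of itself below each letter.

Each γ_k has finite index: G is generated by finitely many torsion elements, and Schur's theorem
applies to G/[γ_k, G]. Since K still moves letters, [K, K] contains γ_n below each letter, so it has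
finite index too. Finally, if g in a normal subgroup N moves a vertex v, a double commutator puts
[K, K] below v into N. Transitivity on levels spreads this to all vertices of the level, and N has
finite index. -/

open scoped commutatorElement

/-! ### Just infiniteness, Schur's theorem and finite index of commutators -/

/-- Being just infinite is invariant under isomorphism. -/
theorem IsJustInfinite.of_mulEquiv {G H : Type*} [Group G] [Group H] (e : G ≃* H)
    (h : IsJustInfinite G) : IsJustInfinite H := by
  refine ⟨e.toEquiv.infinite_iff.1 h.1, fun N hN hN' => ?_⟩
  have hfin := h.2 (N.comap e.toMonoidHom) inferInstance (by
    intro h0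
    apply hN'
    rw [eq_bot_iff]
    intro x hx
    have : e.symm x ∈ N.comap e.toMonoidHom := by simpa using hx
    rw [h0] at this
    simpa using this)
  have h1 : (N.comap e.toMonoidHom).index ≠ 0 := Subgroup.index_ne_zero_of_finite
  rw [Subgroup.index_comap_of_surjective _ e.surjective] at h1
  exact Nat.finite_of_card_ne_zero h1

/-- The commutator of a central subgroup of finite index is finite (Schur). -/
theorem finite_commutator_of_index_center_ne_zero {G : Type*} [Group G]
    (h : (Subgroup.center G).index ≠ 0) : Finite (commutator G) := by
  have : Finite (G ⧸ Subgroup.center G) := Nat.finite_of_card_ne_zero h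
  have : Finite (commutatorSet G) := by
    -- A commutator depends only on the cosets of its entries modulo the center, so there are
    -- finitely many; Schur's theorem then makes the derived subgroup finite.
    refine ((Set.finite_range (fun p : (G ⧸ Subgroup.center G) × (G ⧸ Subgroup.center G) =>
      ⁅p.1.out, p.2.out⁆)).subset ?_)
    rintro _ ⟨a, b, rfl⟩
    refine ⟨(a, b), ?_⟩
    obtain ⟨⟨z, hz⟩, hz'⟩ := QuotientGroup.mk_out_eq_mul (Subgroup.center G) a
    obtain ⟨⟨w, hw⟩, hw'⟩ := QuotientGroup.mk_out_eq_mul (Subgroup.center G) b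
    have hz2 := Subgroup.mem_center_iff.1 hz
    have hw2 := Subgroup.mem_center_iff.1 hw
    have hzi := Subgroup.mem_center_iff.1 (inv_mem hz)
    have hwi := Subgroup.mem_center_iff.1 (inv_mem hw)
    simp only [hz', hw', commutatorElement_def, mul_inv_rev]
    calc a * z * (b * w) * (z⁻¹ * a⁻¹) * (w⁻¹ * b⁻¹)
        = a * (z * (b * w)) * (z⁻¹ * a⁻¹) * (w⁻¹ * b⁻¹) := by group
      _ = a * ((b * w) * z) * (z⁻¹ * a⁻¹) * (w⁻¹ * b⁻¹) := by rw [hz2]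
      _ = a * b * (w * a⁻¹) * (w⁻¹ * b⁻¹) := by group
      _ = a * b * (a⁻¹ * w) * (w⁻¹ * b⁻¹) := by rw [hw2]
      _ = a * b * a⁻¹ * b⁻¹ := by group
  infer_instance

/-- A group generated by finitely many elements of finite order has finite abelianization. -/
theorem finite_abelianization_of_closure {G : Type*} [Group G] {S : Set G} (hS : S.Finite)
    (hgen : Subgroup.closure S = ⊤) (htor : ∀ s ∈ S, IsOfFinOrder s) :
    Finite (Abelianization G) := by
  have hfg : Group.FG G := Group.fg_iff.2 ⟨S, hgen, hS⟩
  have : Group.FG (Abelianization G) :=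
    Group.fg_of_surjective (f := Abelianization.of) QuotientGroup.mk_surjective
  refine CommGroup.finite_of_fg_isMulTorsion _ ?_
  intro x
  obtain ⟨g, rfl⟩ := QuotientGroup.mk_surjective x
  have hg : g ∈ Subgroup.closure S := by rw [hgen]; trivial
  induction hg using Subgroup.closure_induction with
  | mem x hx => exact MonoidHom.isOfFinOrder (Abelianization.of) (htor x hx)
  | one => exact IsOfFinOrder.one
  | mul x y _ _ hx hy => exact IsOfFinOrder.mul hx hy
  | inv x _ hx => exact IsOfFinOrder.inv hx

/-- If `G` is generated by finitely many elements of finite order and `L` is normal of finite index,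
then `⁅L, G⁆` has finite index. -/
theorem index_commutator_top_ne_zero {G : Type*} [Group G] {S : Set G} (hS : S.Finite)
    (hgen : Subgroup.closure S = ⊤) (htor : ∀ s ∈ S, IsOfFinOrder s)
    (L : Subgroup G) [L.Normal] (hL : L.index ≠ 0) : ⁅L, (⊤ : Subgroup G)⁆.index ≠ 0 := by
  set M := ⁅L, (⊤ : Subgroup G)⁆ with hM
  let π := QuotientGroup.mk' M
  have hπ : Function.Surjective π := QuotientGroup.mk'_surjective M
  -- Dividing by [L, G] makes L central. The quotient then has finite derived subgroup by Schur and
  -- finite abelianization by torsion generation.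
  have hc : L.map π ≤ Subgroup.center (G ⧸ M) := by
    rintro _ ⟨l, hl, rfl⟩
    rw [Subgroup.mem_center_iff]
    intro q
    obtain ⟨g, rfl⟩ := hπ q
    rw [← map_mul, ← map_mul]
    refine (QuotientGroup.eq.2 ?_)
    have h1 : ⁅l⁻¹, g⁻¹⁆ ∈ M :=
      Subgroup.commutator_mem_commutator (inv_mem hl) (Subgroup.mem_top _)
    simpa [commutatorElement_def, mul_assoc] using h1
  have hci : (Subgroup.center (G ⧸ M)).index ≠ 0 := by
    have h1 : (L.map π).index ≠ 0 := by
      rw [Subgroup.index_map_eq L hπ]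
      · exact hL
      · rw [QuotientGroup.ker_mk']
        exact Subgroup.commutator_le_left L ⊤
    intro h
    exact h1 (Nat.eq_zero_of_zero_dvd (h ▸ Subgroup.index_dvd_of_le hc))
  have h1 := finite_commutator_of_index_center_ne_zero hci
  have h2 : Finite (Abelianization (G ⧸ M)) := by
    refine finite_abelianization_of_closure (S := π '' S) (hS.image _) ?_ ?_
    · rw [← MonoidHom.map_closure, hgen, ← MonoidHom.range_eq_map, MonoidHom.range_eq_top.2 hπ]
    · rintro _ ⟨s, hs, rfl⟩
      exact MonoidHom.isOfFinOrder _ (htor s hs)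
  have h3 : Finite (G ⧸ M) := by
    apply Nat.finite_of_card_ne_zero
    rw [← Subgroup.card_mul_index (commutator (G ⧸ M))]
    exact mul_ne_zero Nat.card_pos.ne' (Nat.card_pos (α := Abelianization (G ⧸ M))).ne'
  exact Subgroup.index_ne_zero_of_finite

/-- The relative version of `index_commutator_top_ne_zero`. -/
theorem relIndex_commutator_ne_zero {A : Type*} [Group A] {S : Set A} (hS : S.Finite)
    (htor : ∀ s ∈ S, IsOfFinOrder s) {L : Subgroup A} (hle : L ≤ Subgroup.closure S)
    (hn : ∀ g ∈ Subgroup.closure S, ∀ l ∈ L, g * l * g⁻¹ ∈ L)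
    (hL : L.relIndex (Subgroup.closure S) ≠ 0) :
    ⁅L, Subgroup.closure S⁆.relIndex (Subgroup.closure S) ≠ 0 := by
  set G := Subgroup.closure S with hG
  have hnor : (L.subgroupOf G).Normal :=
    ⟨fun l hl g => by
      rw [Subgroup.mem_subgroupOf] at hl ⊢
      exact hn g g.2 l hl⟩
  have h := index_commutator_top_ne_zero (G := G) (S := Subtype.val ⁻¹' S)
    (hS.preimage Subtype.val_injective.injOn)
    (Subgroup.closure_closure_coe_preimage) (by
      intro s hs
      exact Submonoid.isOfFinOrder_coe.1 (htor s hs)) (L.subgroupOf G) hL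
  have h2 : (⁅L.subgroupOf G, (⊤ : Subgroup G)⁆).map G.subtype = ⁅L, G⁆ := by
    rw [Subgroup.map_commutator, Subgroup.subgroupOf_map_subtype, inf_of_le_left hle,
      ← MonoidHom.range_eq_map, Subgroup.range_subtype]
  rw [← h2, Subgroup.relIndex, Subgroup.subgroupOf, Subgroup.comap_map_eq_self_of_injective]
  · exact h
  · exact Subtype.val_injective

/-! ### The case n = 3: an infinite dihedral quotient -/

/-- The action of the generators of the Hanoi towers group on `ℤ`: two of them are point reflections
and the third is trivial. -/
def hanoiRefl (i : Fin 3) : Equiv.Perm ℤ :=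
  if i = 0 then Equiv.neg ℤ else if i = 1 then Equiv.subLeft 1 else 1

theorem hanoiRefl_mul_self (i : Fin 3) : hanoiRefl i * hanoiRefl i = 1 := by
  ext m
  fin_cases i <;> simp [hanoiRefl]

/-- The tree automorphism spelled by a word in the generators. -/
def evalWord {n : ℕ} (l : List (Fin n)) : Equiv.Perm (List (Fin n)) := (l.map genPerm).prod

/-- The action on the first level of the automorphism spelled by a word. -/
def rootWord {n : ℕ} (l : List (Fin n)) : Equiv.Perm (Fin n) := (l.map sigmaPerm).prod

/-- A word spelling the section at the letter `p` of the automorphism spelled by a word. -/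
def sectionWord {n : ℕ} : List (Fin n) → Fin n → List (Fin n)
  | [], _ => []
  | i :: l, p => if rootWord l p = i then i :: sectionWord l p else sectionWord l p

/-- The permutation of `ℤ` spelled by a word. -/
def reflWord (l : List (Fin 3)) : Equiv.Perm ℤ := (l.map hanoiRefl).prod

theorem genPerm_cons {n : ℕ} (i x : Fin n) (w : List (Fin n)) :
    genPerm i (x :: w) = sigmaPerm i x :: (if x = i then genPerm i w else w) := rfl

theorem genPerm_nil {n : ℕ} (i : Fin n) : genPerm i [] = [] := rfl

theorem evalWord_cons_apply {n : ℕ} (l : List (Fin n)) (p : Fin n) (w : List (Fin n)) :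
    evalWord l (p :: w) = rootWord l p :: evalWord (sectionWord l p) w := by
  induction l with
  | nil => simp [evalWord, rootWord, sectionWord]
  | cons i l ih =>
    have h1 : evalWord (i :: l) (p :: w) = genPerm i (evalWord l (p :: w)) := by
      simp [evalWord]
    have h2 : rootWord (i :: l) p = sigmaPerm i (rootWord l p) := by simp [rootWord]
    rw [h1, ih, genPerm_cons, h2]
    by_cases h : rootWord l p = i
    · simp [sectionWord, h, evalWord]
    · simp [sectionWord, h]

/-- Each letter of the word is recorded in exactly one section. -/
theorem sum_length_sectionWord {n : ℕ} (l : List (Fin n)) :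
    ∑ p, (sectionWord l p).length = l.length := by
  induction l with
  | nil => simp [sectionWord]
  | cons i l ih =>
    have h : ∀ p, (sectionWord (i :: l) p).length =
        (sectionWord l p).length + if p = (rootWord l).symm i then 1 else 0 := by
      intro p
      have h0 : p = (rootWord l).symm i ↔ rootWord l p = i := Equiv.eq_symm_apply _
      by_cases h : rootWord l p = i <;> simp [sectionWord, h0, h]
    simp [h, Finset.sum_add_distrib, ih]

theorem length_sectionWord_le {n : ℕ} (l : List (Fin n)) (p : Fin n) :
    (sectionWord l p).length ≤ l.length := by
  rw [← sum_length_sectionWord l]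
  exact Finset.single_le_sum (f := fun p => (sectionWord l p).length) (fun _ _ => Nat.zero_le _)
    (Finset.mem_univ p)

/-- If the section at p records every letter, the first one to act is p, which fixes p; so the next
is p again, and so on. -/
theorem eq_replicate_of_length_sectionWord {n : ℕ} (l : List (Fin n)) (p : Fin n)
    (h : (sectionWord l p).length = l.length) : l = List.replicate l.length p := by
  induction l with
  | nil => rfl
  | cons i l ih =>
    have hle := length_sectionWord_le l p
    by_cases hi : rootWord l p = i
    · simp only [sectionWord, hi, if_true, List.length_cons, add_left_inj] at h
      have hl := ih h
      have hp : ∀ k, rootWord (List.replicate k p) p = p := by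
        intro k
        induction k with
        | zero => simp [rootWord]
        | succ k ihk =>
          have : rootWord (List.replicate (k + 1) p) p =
            sigmaPerm p (rootWord (List.replicate k p) p) := by
            simp [rootWord, pow_succ']
          rw [this, ihk, sigmaPerm_self]
      rw [hl, hp] at hi
      rw [List.length_cons, List.replicate_succ, ← hl, hi]
    · simp only [sectionWord, hi, if_false, List.length_cons] at h
      omega

/-- The key identity: the action on `ℤ` is determined by the actions of the three sections. -/
theorem reflWord_apply (l : List (Fin 3)) (m : ℤ) :
    reflWord l m = reflWord (sectionWord l ((rootWord l).symm 0)) m +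
      reflWord (sectionWord l ((rootWord l).symm 1)) m -
      reflWord (sectionWord l ((rootWord l).symm 2)) m := by
  induction l with
  | nil => simp [sectionWord, reflWord]
  | cons i l ih =>
    have h1 : ∀ x, (rootWord (i :: l)).symm x = (rootWord l).symm ((sigmaPerm i).symm x) := by
      intro x
      rw [Equiv.symm_apply_eq]
      simp [rootWord]
    have h2 : reflWord (i :: l) m = hanoiRefl i (reflWord l m) := by simp [reflWord]
    -- Sections are indexed by the letter where they end: prepending i then changes only the section
    -- ending at i, and the other two are swapped by σ_i. The signs +, +, - are compatible with all
    -- three generators, and they sum to 1, as the empty word requires.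
    have h3 : ∀ y, reflWord (sectionWord (i :: l) ((rootWord l).symm y)) m =
        if y = i then hanoiRefl i (reflWord (sectionWord l ((rootWord l).symm y)) m)
        else reflWord (sectionWord l ((rootWord l).symm y)) m := by
      intro y
      by_cases h : y = i <;> simp [sectionWord, h, reflWord]
    rw [h2, h1, h1, h1, h3, h3, h3, ih]
    have hs : ∀ i : Fin 3, (sigmaPerm i).symm i = i := fun i => by
      rw [Equiv.symm_apply_eq, sigmaPerm_self]
    have s01 : (sigmaPerm (0 : Fin 3)).symm 1 = 2 := by decide
    have s02 : (sigmaPerm (0 : Fin 3)).symm 2 = 1 := by decide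
    have s10 : (sigmaPerm (1 : Fin 3)).symm 0 = 2 := by decide
    have s12 : (sigmaPerm (1 : Fin 3)).symm 2 = 0 := by decide
    have s20 : (sigmaPerm (2 : Fin 3)).symm 0 = 1 := by decide
    have s21 : (sigmaPerm (2 : Fin 3)).symm 1 = 0 := by decide
    fin_cases i
    · simp [hs, s01, s02, hanoiRefl]; ring
    · simp [hs, s10, s12, hanoiRefl]; ring
    · simp [hs, s20, s21, hanoiRefl]; ring

theorem genPerm_mul_self (i : Fin 3) : genPerm i * genPerm i = 1 := by
  ext1 w
  have hs : ∀ i x : Fin 3, sigmaPerm i (sigmaPerm i x) = x := by decide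
  induction w with
  | nil => rfl
  | cons x w ih =>
    by_cases h : x = i
    · simpa [genPerm_cons, h, sigmaPerm_self] using ih
    · simp [genPerm_cons, h, hs, sigmaPerm_eq_iff]

theorem genPerm_ne_one (i : Fin 3) : genPerm i ≠ 1 := by
  intro h
  have h1 : ∀ i : Fin 3, ∃ x, sigmaPerm i x ≠ x := by decide
  obtain ⟨x, hx⟩ := h1 i
  have := congrArg (fun g => g [x]) h
  simp only [genPerm_cons, Equiv.Perm.one_apply, List.cons.injEq] at this
  exact hx this.1

/-- Handles words that are powers of one generator, where passing to sections does not shorten: only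
the parity of the exponent matters. -/
theorem pow_eq_one_transfer {G H : Type*} [Group G] [Group H] {g : G} {h : H} (hg : g * g = 1)
    (hg1 : g ≠ 1) (hh : h * h = 1) {k : ℕ} (hk : g ^ k = 1) : h ^ k = 1 := by
  rcases Nat.even_or_odd' k with ⟨j, rfl | rfl⟩
  · rw [pow_mul, pow_two, hh, one_pow]
  · rw [pow_succ, pow_mul, pow_two, hg, one_pow, one_mul] at hk
    exact absurd hk hg1

/-- Every relation of the Hanoi towers group holds for the action on `ℤ`. -/
theorem reflWord_eq_one (l : List (Fin 3)) (h : evalWord l = 1) : reflWord l = 1 := by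
  induction hk : l.length using Nat.strong_induction_on generalizing l with
  | _ k ih =>
  have hsec : ∀ p, evalWord (sectionWord l p) = 1 := by
    intro p
    ext1 w
    have := evalWord_cons_apply l p w
    rw [h, Equiv.Perm.one_apply, List.cons.injEq] at this
    exact this.2.symm
  by_cases hlt : ∀ p, (sectionWord l p).length < l.length
  · have h1 : ∀ p, reflWord (sectionWord l p) = 1 := fun p =>
      ih _ (hk ▸ hlt p) _ (hsec p) rfl
    ext m
    rw [reflWord_apply, h1, h1, h1]
    simp
  · push Not at hlt
    obtain ⟨p, hp⟩ := hlt
    have hl := eq_replicate_of_length_sectionWord l p (le_antisymm (length_sectionWord_le l p) hp)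
    rw [hl] at h ⊢
    simp only [evalWord, reflWord, List.map_replicate, List.prod_replicate] at h ⊢
    exact pow_eq_one_transfer (genPerm_mul_self p) (genPerm_ne_one p) (hanoiRefl_mul_self p) h

/-- The group generated by the automorphisms `a_i`, as permutations of the set of words. -/
def genGroup (n : ℕ) : Subgroup (Equiv.Perm (List (Fin n))) :=
  Subgroup.closure (Set.range genPerm)

/-- The graph of the action of the Hanoi towers group on `ℤ`. -/
def reflGraph : Subgroup (Equiv.Perm (List (Fin 3)) × Equiv.Perm ℤ) :=
  Subgroup.closure (Set.range fun i => (genPerm i, hanoiRefl i))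

theorem exists_word_of_mem_reflGraph {x : Equiv.Perm (List (Fin 3)) × Equiv.Perm ℤ}
    (hx : x ∈ reflGraph) : ∃ l, x = (evalWord l, reflWord l) := by
  induction hx using Subgroup.closure_induction with
  | mem x hx =>
    obtain ⟨i, rfl⟩ := hx
    exact ⟨[i], by simp [evalWord, reflWord]⟩
  | one => exact ⟨[], rfl⟩
  | mul x y _ _ hx hy =>
    obtain ⟨l, rfl⟩ := hx
    obtain ⟨l', rfl⟩ := hy
    exact ⟨l ++ l', by simp [evalWord, reflWord]⟩
  | inv x _ hx =>
    obtain ⟨l, rfl⟩ := hx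
    refine ⟨l.reverse, ?_⟩
    have h1 : ∀ i : Fin 3, (genPerm i)⁻¹ = genPerm i := fun i =>
      inv_eq_of_mul_eq_one_left (genPerm_mul_self i)
    have h2 : ∀ i : Fin 3, (hanoiRefl i)⁻¹ = hanoiRefl i := fun i =>
      inv_eq_of_mul_eq_one_left (hanoiRefl_mul_self i)
    simp [evalWord, reflWord, List.prod_inv_reverse, Function.comp_def, h1, h2]

theorem eq_one_of_mem_reflGraph {t : Equiv.Perm ℤ} (h : (1, t) ∈ reflGraph) : t = 1 := by
  obtain ⟨l, hl⟩ := exists_word_of_mem_reflGraph h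
  rw [Prod.mk.injEq] at hl
  rw [hl.2, reflWord_eq_one l hl.1.symm]

theorem exists_mem_reflGraph {g : Equiv.Perm (List (Fin 3))} (hg : g ∈ genGroup 3) :
    ∃ t, (g, t) ∈ reflGraph := by
  induction hg using Subgroup.closure_induction with
  | mem x hx =>
    obtain ⟨i, rfl⟩ := hx
    exact ⟨hanoiRefl i, Subgroup.subset_closure ⟨i, rfl⟩⟩
  | one => exact ⟨1, one_mem _⟩
  | mul x y _ _ hx hy =>
    obtain ⟨s, hs⟩ := hx
    obtain ⟨t, ht⟩ := hy
    exact ⟨s * t, mul_mem hs ht⟩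
  | inv x _ hx =>
    obtain ⟨s, hs⟩ := hx
    exact ⟨s⁻¹, inv_mem hs⟩

theorem hanoiRefl_translation_pow (k : ℕ) (m : ℤ) :
    ((hanoiRefl 1 * hanoiRefl 0) ^ k) m = m + k := by
  induction k with
  | zero => simp
  | succ k ih =>
    rw [pow_succ', Equiv.Perm.mul_apply, ih]
    simp [hanoiRefl]
    ring

/-- The Hanoi towers group on three pegs is not just infinite. -/
theorem not_isJustInfinite_genGroup_three : ¬ IsJustInfinite (genGroup 3) := by
  rintro ⟨-, h⟩
  have hmem : ∀ i, genPerm i ∈ genGroup 3 := fun i => Subgroup.subset_closure ⟨i, rfl⟩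
  -- The kernel of the homomorphism to `Equiv.Perm ℤ` whose graph is `reflGraph`.
  let N : Subgroup (genGroup 3) :=
    reflGraph.comap ((MonoidHom.inl _ _).comp (genGroup 3).subtype)
  have hN : ∀ g : genGroup 3, g ∈ N ↔ ((g : Equiv.Perm (List (Fin 3))), 1) ∈ reflGraph :=
    fun g => Iff.rfl
  have hnor : N.Normal := by
    refine ⟨fun x hx g => ?_⟩
    rw [hN] at hx ⊢
    obtain ⟨t, ht⟩ := exists_mem_reflGraph g.2
    simpa using mul_mem (mul_mem ht hx) (inv_mem ht)
  have hne : N ≠ ⊥ := by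
    intro h0
    have h1 : (⟨genPerm 2, hmem 2⟩ : genGroup 3) ∈ N :=
      Subgroup.subset_closure ⟨2, by simp [hanoiRefl]⟩
    rw [h0, Subgroup.mem_bot] at h1
    exact genPerm_ne_one 2 (congrArg Subtype.val h1)
  have hfin := h N hnor hne
  -- The product of the two reflections is the translation by 1. If N had finite index, a positive
  -- power of it would be trivial.
  obtain ⟨k, hk, -, hkN⟩ := N.exists_pow_mem_of_index_ne_zero Subgroup.index_ne_zero_of_finite
    (⟨genPerm 1, hmem 1⟩ * ⟨genPerm 0, hmem 0⟩)
  rw [hN] at hkN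
  have hgen : ∀ i, (genPerm i, hanoiRefl i) ∈ reflGraph := fun i =>
    Subgroup.subset_closure ⟨i, rfl⟩
  have hq := mul_mem (inv_mem hkN) (pow_mem (mul_mem (hgen 1) (hgen 0)) k)
  simp only [Prod.mk_mul_mk, Prod.pow_mk, Prod.inv_mk, Subgroup.coe_pow, Subgroup.coe_mul,
    inv_one, one_mul, inv_mul_cancel] at hq
  have h1 := congrArg (fun f => f 0) (eq_one_of_mem_reflGraph hq)
  simp only [hanoiRefl_translation_pow, Equiv.Perm.one_apply] at h1
  omega

/-! ### Sections, self-replication and transitivity on letters -/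

section Sections

variable {n : ℕ}

/-- The permutation which acts by `g` on the words starting with `p`, and fixes the other words. -/
def actBelow (p : Fin n) : Equiv.Perm (List (Fin n)) →* Equiv.Perm (List (Fin n)) where
  toFun g :=
    { toFun := fun v => match v with
        | [] => []
        | x :: w => x :: (if x = p then g w else w)
      invFun := fun v => match v with
        | [] => []
        | x :: w => x :: (if x = p then g.symm w else w)
      left_inv := by
        rintro (_ | ⟨x, w⟩)
        · rfl
        · by_cases h : x = p <;> simp [h]
      right_inv := by
        rintro (_ | ⟨x, w⟩)
        · rfl
        · by_cases h : x = p <;> simp [h] }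
  map_one' := by
    ext1 v
    rcases v with (_ | ⟨x, w⟩)
    · rfl
    · simp
  map_mul' g h := by
    ext1 v
    rcases v with (_ | ⟨x, w⟩)
    · rfl
    · by_cases h : x = p <;> simp [h]

theorem actBelow_nil (p : Fin n) (g : Equiv.Perm (List (Fin n))) : actBelow p g [] = [] := rfl

theorem actBelow_cons (p x : Fin n) (g : Equiv.Perm (List (Fin n))) (w : List (Fin n)) :
    actBelow p g (x :: w) = x :: (if x = p then g w else w) := rfl

/-- `g` maps the words starting with `x` to the words starting with `y`, acting by `h` on the
remaining letters. -/
def HasSection (g : Equiv.Perm (List (Fin n))) (x y : Fin n) (h : Equiv.Perm (List (Fin n))) :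
    Prop := ∀ w, g (x :: w) = y :: h w

theorem HasSection.one (x : Fin n) : HasSection 1 x x 1 := fun _ => rfl

theorem HasSection.mul {g g' h h' : Equiv.Perm (List (Fin n))} {x y z : Fin n}
    (hg : HasSection g y z h) (hg' : HasSection g' x y h') : HasSection (g * g') x z (h * h') :=
  fun w => by rw [Equiv.Perm.mul_apply, hg', hg, Equiv.Perm.mul_apply]

theorem HasSection.inv {g h : Equiv.Perm (List (Fin n))} {x y : Fin n}
    (hg : HasSection g x y h) : HasSection g⁻¹ y x h⁻¹ := fun w => by
  rw [Equiv.Perm.inv_eq_iff_eq, hg]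
  simp

theorem HasSection.pow {g h : Equiv.Perm (List (Fin n))} {x : Fin n}
    (hg : HasSection g x x h) (k : ℕ) : HasSection (g ^ k) x x (h ^ k) := by
  induction k with
  | zero => exact HasSection.one x
  | succ k ih => rw [pow_succ, pow_succ]; exact ih.mul hg

theorem HasSection.congr {g h h' : Equiv.Perm (List (Fin n))} {x y : Fin n}
    (hg : HasSection g x y h) (e : h = h') : HasSection g x y h' := e ▸ hg

theorem HasSection.letter_unique {g h h' : Equiv.Perm (List (Fin n))} {x y y' : Fin n}
    (hg : HasSection g x y h) (hg' : HasSection g x y' h') : y = y' := by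
  have := (hg []).symm.trans (hg' [])
  exact (List.cons.inj this).1

theorem hasSection_genPerm (i x : Fin n) :
    HasSection (genPerm i) x (sigmaPerm i x) (if x = i then genPerm i else 1) := fun w => by
  rw [genPerm_cons]
  by_cases h : x = i <;> simp [h]

theorem hasSection_genPerm_self (i : Fin n) : HasSection (genPerm i) i i (genPerm i) := fun w => by
  rw [genPerm_cons, if_pos rfl, sigmaPerm_self]

theorem hasSection_genPerm_of_ne {i x : Fin n} (h : x ≠ i) :
    HasSection (genPerm i) x (sigmaPerm i x) 1 := fun w => by
  rw [genPerm_cons, if_neg h, Equiv.Perm.one_apply]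

theorem hasSection_actBelow_self (p : Fin n) (g : Equiv.Perm (List (Fin n))) :
    HasSection (actBelow p g) p p g := fun w => by rw [actBelow_cons, if_pos rfl]

theorem hasSection_actBelow_of_ne {p x : Fin n} (h : x ≠ p) (g : Equiv.Perm (List (Fin n))) :
    HasSection (actBelow p g) x x 1 := fun w => by
  rw [actBelow_cons, if_neg h, Equiv.Perm.one_apply]

theorem eq_of_hasSection {g g' : Equiv.Perm (List (Fin n))} (hnil : g [] = g' [])
    (h : ∀ x, ∃ y k, HasSection g x y k ∧ HasSection g' x y k) : g = g' := by
  ext1 v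
  rcases v with (_ | ⟨x, w⟩)
  · exact hnil
  · obtain ⟨y, k, h1, h2⟩ := h x
    rw [h1, h2]

theorem genPerm_mem (i : Fin n) : genPerm i ∈ genGroup n := Subgroup.subset_closure ⟨i, rfl⟩

theorem apply_nil_of_mem {g : Equiv.Perm (List (Fin n))} (hg : g ∈ genGroup n) : g [] = [] := by
  induction hg using Subgroup.closure_induction with
  | mem x hx => obtain ⟨i, rfl⟩ := hx; rfl
  | one => rfl
  | mul x y _ _ hx hy => rw [Equiv.Perm.mul_apply, hy, hx]
  | inv x _ hx => rw [Equiv.Perm.inv_eq_iff_eq, hx]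

theorem exists_hasSection {g : Equiv.Perm (List (Fin n))} (hg : g ∈ genGroup n) (x : Fin n) :
    ∃ y, ∃ h ∈ genGroup n, HasSection g x y h := by
  induction hg using Subgroup.closure_induction generalizing x with
  | mem g hg =>
    obtain ⟨i, rfl⟩ := hg
    refine ⟨_, _, ?_, hasSection_genPerm i x⟩
    split_ifs
    · exact genPerm_mem i
    · exact one_mem _
  | one => exact ⟨x, 1, one_mem _, HasSection.one x⟩
  | mul a b _ _ ha hb =>
    obtain ⟨y, h, hh, hs⟩ := hb x
    obtain ⟨z, k, hk, hs'⟩ := ha y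
    exact ⟨z, _, mul_mem hk hh, hs'.mul hs⟩
  | inv a ha' ha =>
    -- The induced map on letters is injective on a finite set, hence onto; a preimage of x gives
    -- the section of the inverse at x.
    have hinj : Function.Injective fun x => (ha x).choose := by
      intro x x' hxx
      obtain ⟨h, -, hs⟩ := (ha x).choose_spec
      obtain ⟨h', -, hs'⟩ := (ha x').choose_spec
      simp only at hxx
      rw [← hxx] at hs'
      have := (hs.inv.letter_unique hs'.inv)
      exact this
    obtain ⟨y, hy⟩ := Finite.surjective_of_injective hinj x
    obtain ⟨h, hh, hs⟩ := (ha y).choose_spec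
    simp only at hy
    rw [hy] at hs
    exact ⟨y, h⁻¹, inv_mem hh, hs.inv⟩

/-- `g` fixes all the words of length one. -/
def FixesLetters (g : Equiv.Perm (List (Fin n))) : Prop := ∀ x, g [x] = [x]

theorem HasSection.apply_singleton {g h : Equiv.Perm (List (Fin n))} {x y : Fin n}
    (hg : HasSection g x y h) (hmem : h ∈ genGroup n) : g [x] = [y] := by
  rw [hg, apply_nil_of_mem hmem]

theorem FixesLetters.exists_hasSection {g : Equiv.Perm (List (Fin n))} (hf : FixesLetters g)
    (hg : g ∈ genGroup n) (x : Fin n) : ∃ h ∈ genGroup n, HasSection g x x h := by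
  obtain ⟨y, h, hh, hs⟩ := _root_.exists_hasSection hg x
  have h1 := (hs.apply_singleton hh).symm.trans (hf x)
  obtain rfl : y = x := by simpa using h1
  exact ⟨h, hh, hs⟩

theorem FixesLetters.one : FixesLetters (1 : Equiv.Perm (List (Fin n))) := fun _ => rfl

theorem FixesLetters.mul {g h : Equiv.Perm (List (Fin n))} (hg : FixesLetters g)
    (hh : FixesLetters h) : FixesLetters (g * h) := fun x => by
  rw [Equiv.Perm.mul_apply, hh, hg]

theorem FixesLetters.inv {g : Equiv.Perm (List (Fin n))} (hg : FixesLetters g) :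
    FixesLetters g⁻¹ := fun x => by rw [Equiv.Perm.inv_eq_iff_eq, hg]

theorem FixesLetters.conj {g k : Equiv.Perm (List (Fin n))} (hg : FixesLetters g)
    (hk : k ∈ genGroup n) : FixesLetters (k * g * k⁻¹) := fun x => by
  obtain ⟨y, h, hh, hs⟩ := _root_.exists_hasSection (inv_mem hk) x
  have h1 := hs.apply_singleton hh
  rw [Equiv.Perm.mul_apply, Equiv.Perm.mul_apply, h1, hg, ← h1]
  simp

/-- Conjugation moves `actBelow`. -/
theorem conj_actBelow {g h k : Equiv.Perm (List (Fin n))} {p q : Fin n} (hg : g ∈ genGroup n)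
    (hs : HasSection g p q h) : g * actBelow p k * g⁻¹ = actBelow q (h * k * h⁻¹) := by
  refine eq_of_hasSection ?_ fun x => ?_
  · rw [Equiv.Perm.mul_apply, Equiv.Perm.mul_apply, apply_nil_of_mem (inv_mem hg), actBelow_nil,
      actBelow_nil, apply_nil_of_mem hg]
  · by_cases hx : x = q
    · subst hx
      exact ⟨x, _, (hs.mul (hasSection_actBelow_self p k)).mul hs.inv,
        hasSection_actBelow_self x _⟩
    · obtain ⟨y, u, -, hu⟩ := exists_hasSection (inv_mem hg) x
      have hy : y ≠ p := by
        rintro rfl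
        exact hx (hu.inv.letter_unique (by simpa using hs))
      refine ⟨x, 1, ?_, hasSection_actBelow_of_ne hx _⟩
      have := (hu.inv.mul (hasSection_actBelow_of_ne hy k)).mul hu
      simpa using this

/-! ### Transitivity -/

theorem exists_pow_sigmaPerm {i p q : Fin n} (hp : p ≠ i) (hq : q ≠ i) :
    ∃ m : ℕ, (sigmaPerm i ^ m) p = q := by
  have h := (((List.nodup_finRange n).filter (fun x => x ≠ i)).isCycleOn_formPerm).2
    (x := p) (by simpa using hp) (y := q) (by simpa using hq)
  obtain ⟨m, hm⟩ := h.exists_nat_pow_eq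
  exact ⟨m, hm⟩

/-- The orbit of p under σ_i avoids i, the only letter with a nontrivial section. -/
theorem hasSection_genPerm_pow {i p : Fin n} (hp : p ≠ i) (m : ℕ) :
    HasSection (genPerm i ^ m) p ((sigmaPerm i ^ m) p) 1 := by
  induction m with
  | zero => exact HasSection.one p
  | succ m ih =>
    rw [pow_succ', pow_succ']
    have h1 : (sigmaPerm i ^ m) p ≠ i := by
      intro h
      apply hp
      have h2 : (sigmaPerm i ^ m) i = i := by
        apply Equiv.Perm.pow_apply_eq_self_of_apply_eq_self
        exact sigmaPerm_self i
      exact (sigmaPerm i ^ m).injective (h.trans h2.symm)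
    simpa using (hasSection_genPerm_of_ne h1).mul ih

theorem exists_ne_ne (hn : 3 ≤ n) (p q : Fin n) : ∃ k, k ≠ p ∧ k ≠ q := by
  obtain ⟨k, hk⟩ := Finset.exists_mem_notMem_of_card_lt_card
    (s := {p, q}) (t := (Finset.univ : Finset (Fin n)))
    (lt_of_le_of_lt Finset.card_le_two (by rw [Finset.card_univ, Fintype.card_fin]; omega))
  exact ⟨k, by simpa using hk.2⟩

/-- A power of a generator whose index differs from p and q; this is where three letters are needed.
-/
theorem exists_hasSection_one (hn : 3 ≤ n) (p q : Fin n) : ∃ g ∈ genGroup n, HasSection g p q 1 := by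
  obtain ⟨k, hkp, hkq⟩ := exists_ne_ne hn p q
  obtain ⟨m, hm⟩ := exists_pow_sigmaPerm hkp.symm hkq.symm
  exact ⟨genPerm k ^ m, pow_mem (genPerm_mem k) m, hm ▸ hasSection_genPerm_pow hkp.symm m⟩

/-- The group `genGroup n` is self-replicating. -/
theorem exists_hasSection_self (hn : 3 ≤ n) (p : Fin n) {h : Equiv.Perm (List (Fin n))}
    (hh : h ∈ genGroup n) : ∃ g ∈ genGroup n, HasSection g p p h := by
  induction hh using Subgroup.closure_induction with
  | mem h hh =>
    obtain ⟨i, rfl⟩ := hh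
    obtain ⟨g, hg, hs⟩ := exists_hasSection_one hn p i
    refine ⟨g⁻¹ * genPerm i * g, mul_mem (mul_mem (inv_mem hg) (genPerm_mem i)) hg, ?_⟩
    simpa using (hs.inv.mul (hasSection_genPerm_self i)).mul hs
  | one => exact ⟨1, one_mem _, HasSection.one p⟩
  | mul a b _ _ ha hb =>
    obtain ⟨g, hg, hs⟩ := ha
    obtain ⟨g', hg', hs'⟩ := hb
    exact ⟨_, mul_mem hg hg', hs.mul hs'⟩
  | inv a _ ha =>
    obtain ⟨g, hg, hs⟩ := ha
    exact ⟨_, inv_mem hg, hs.inv⟩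

/-- Once q is at q', a power of the generator of index q' fixes q' and rotates the remaining
letters. -/
theorem exists_hasSection_two (hn : 3 ≤ n) {p q p' q' : Fin n} (hpq : p ≠ q) (hpq' : p' ≠ q') :
    ∃ g ∈ genGroup n, (∃ h ∈ genGroup n, HasSection g p p' h) ∧
      ∃ h ∈ genGroup n, HasSection g q q' h := by
  obtain ⟨g, hg, hs⟩ := exists_hasSection_one hn q q'
  obtain ⟨r, h, hh, hs'⟩ := exists_hasSection hg p
  have hr : r ≠ q' := by
    rintro rfl
    exact hpq (hs'.inv.letter_unique hs.inv)
  obtain ⟨m, hm⟩ := exists_pow_sigmaPerm hr hpq'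
  refine ⟨genPerm q' ^ m * g, mul_mem (pow_mem (genPerm_mem _) m) hg, ⟨_, ?_,
    (hm ▸ hasSection_genPerm_pow hr m).mul hs'⟩, ⟨_, ?_,
    ((hasSection_genPerm_self q').pow m).mul hs⟩⟩
  · simpa using hh
  · simpa using pow_mem (genPerm_mem q') m

end Sections

/-! ### Sections of the first-level stabilizer -/

section Stabilizer

variable {n : ℕ}

/-- The cycle `(1, 2, …, n)`. -/
def fullCycle (n : ℕ) : Equiv.Perm (Fin n) := (List.finRange n).formPerm

theorem fullCycle_val (z : Fin n) : (fullCycle n z).val = if z.val + 1 = n then 0 else z.val + 1 := by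
  have h := List.formPerm_apply_getElem (List.finRange n) (List.nodup_finRange n) z.val
    (by simp)
  simp only [List.getElem_finRange, List.length_finRange] at h
  have h1 : (fullCycle n z).val = (z.val + 1) % n := congrArg Fin.val h
  rw [h1]
  have := z.isLt
  split_ifs with h2
  · rw [h2, Nat.mod_self]
  · exact Nat.mod_eq_of_lt (by omega)

/-- Makes σ_i σ_j⁻¹ a product of two transpositions, because the full cycle cancels. -/
theorem sigmaPerm_eq (hn : 2 ≤ n) (i : Fin n) :
    sigmaPerm i = Equiv.swap i (fullCycle n i) * fullCycle n := by
  obtain ⟨l₁, l₂, h⟩ := List.append_of_mem (List.mem_finRange i)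
  have hnd : (l₁ ++ i :: l₂).Nodup := h ▸ List.nodup_finRange n
  have hnd' := List.nodup_middle.1 hnd
  rw [List.nodup_cons, List.mem_append, not_or] at hnd'
  have hfilter : (List.finRange n).filter (fun x => x ≠ i) = l₁ ++ l₂ := by
    rw [h, List.filter_append, List.filter_cons_of_neg (by simp), List.filter_eq_self.2,
      List.filter_eq_self.2]
    · intro a ha
      have hai : a ≠ i := by rintro rfl; exact hnd'.1.2 ha
      simpa using hai
    · intro a ha
      have hai : a ≠ i := by rintro rfl; exact hnd'.1.1 ha
      simpa using hai
  have h1 : sigmaPerm i = (l₂ ++ l₁).formPerm := by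
    rw [sigmaPerm, hfilter]
    exact List.formPerm_eq_of_isRotated hnd'.2 List.isRotated_append
  have hrot : (l₁ ++ i :: l₂) ~r (i :: (l₂ ++ l₁)) := List.isRotated_append
  have h2 : fullCycle n = (i :: (l₂ ++ l₁)).formPerm := by
    rw [fullCycle, h]
    exact List.formPerm_eq_of_isRotated hnd hrot
  have hnd2 : (i :: (l₂ ++ l₁)).Nodup := hrot.nodup_iff.1 hnd
  have hlen : (l₂ ++ l₁).length + 1 = n := by
    have := congrArg List.length h
    simp at this ⊢
    omega
  rcases hl : l₂ ++ l₁ with _ | ⟨b, l⟩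
  · rw [hl] at hlen
    simp at hlen
    omega
  · rw [hl] at h1 h2 hnd2
    have h3 : fullCycle n i = b := by rw [h2, List.formPerm_apply_head _ _ _ hnd2]
    rw [h3, h2, List.formPerm_cons_cons, ← mul_assoc, Equiv.swap_mul_self, one_mul, h1]

/-- Take five consecutive letters i, p, j, k, q on the cycle. Then a_i a_j⁻¹ acts on letters as (i
p)(j k) and fixes q with trivial section. Its square fixes all letters and has section a_i at i,
collected on the step from p back to i. -/
theorem exists_base_of_five_le (hn : 5 ≤ n) (i : Fin n) : ∃ p q, p ≠ q ∧ ∃ w ∈ genGroup n,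
    FixesLetters w ∧ HasSection w p p (genPerm i) ∧ HasSection w q q 1 := by
  set c := fullCycle n with hc
  have hval := fullCycle_val (n := n)
  rw [← hc] at hval
  obtain ⟨j, hj⟩ : ∃ j, j = c (c i) := ⟨_, rfl⟩
  obtain ⟨k, hk⟩ : ∃ k, k = c j := ⟨_, rfl⟩
  obtain ⟨q, hq⟩ : ∃ q, q = c k := ⟨_, rfl⟩
  obtain ⟨p, hp⟩ : ∃ p, p = c i := ⟨_, rfl⟩
  rw [← hp] at hj
  have vj := hval p
  have vk := hval j
  have vq := hval k
  have vp := hval i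
  rw [← hj] at vj
  rw [← hk] at vk
  rw [← hq] at vq
  rw [← hp] at vp
  have li := i.isLt
  have lj := j.isLt
  have lk := k.isLt
  have lp := p.isLt
  have lq := q.isLt
  have hip : i ≠ p := fun h => by have := congrArg Fin.val h; split_ifs at * <;> omega
  have hij : i ≠ j := fun h => by have := congrArg Fin.val h; split_ifs at * <;> omega
  have hik : i ≠ k := fun h => by have := congrArg Fin.val h; split_ifs at * <;> omega
  have hiq : i ≠ q := fun h => by have := congrArg Fin.val h; split_ifs at * <;> omega
  have hpj : p ≠ j := fun h => by have := congrArg Fin.val h; split_ifs at * <;> omega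
  have hpk : p ≠ k := fun h => by have := congrArg Fin.val h; split_ifs at * <;> omega
  have hpq : p ≠ q := fun h => by have := congrArg Fin.val h; split_ifs at * <;> omega
  have hjk : j ≠ k := fun h => by have := congrArg Fin.val h; split_ifs at * <;> omega
  have hjq : j ≠ q := fun h => by have := congrArg Fin.val h; split_ifs at * <;> omega
  have hkq : k ≠ q := fun h => by have := congrArg Fin.val h; split_ifs at * <;> omega
  have hsi : ∀ z, sigmaPerm i z = Equiv.swap i p (c z) := fun z => by
    rw [sigmaPerm_eq (by omega), ← hc, ← hp, Equiv.Perm.mul_apply]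
  have hsj : ∀ z, (sigmaPerm j).symm z = c.symm (Equiv.swap j k z) := fun z => by
    rw [Equiv.symm_apply_eq, sigmaPerm_eq (by omega), ← hc, ← hk, Equiv.Perm.mul_apply]
    simp
  have hroot : ∀ z, sigmaPerm i ((sigmaPerm j).symm z) = Equiv.swap i p (Equiv.swap j k z) :=
    fun z => by rw [hsi, hsj, Equiv.apply_symm_apply]
  have hgen : ∀ z, ∃ h ∈ genGroup n, HasSection (genPerm i * (genPerm j)⁻¹) z
      (Equiv.swap i p (Equiv.swap j k z)) h := by
    intro z
    refine ⟨_, ?_, hroot z ▸ (hasSection_genPerm i _).mul (HasSection.inv (x := (sigmaPerm j).symm z)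
      (h := if (sigmaPerm j).symm z = j then genPerm j else 1) ?_)⟩
    · refine mul_mem ?_ (inv_mem ?_) <;> split_ifs <;> first | exact genPerm_mem _ | exact one_mem _
    · simpa using hasSection_genPerm j ((sigmaPerm j).symm z)
  have hinv : ∀ z, z ≠ j → HasSection (genPerm j)⁻¹ z ((sigmaPerm j).symm z) 1 := by
    intro z hz
    have h1 : (sigmaPerm j).symm z ≠ j := fun h => hz ((sigmaPerm_symm_eq_iff j z).1 h)
    simpa using (hasSection_genPerm_of_ne h1).inv
  have hpi : (sigmaPerm j).symm p = i := by
    rw [hsj, Equiv.swap_apply_of_ne_of_ne hpj hpk, hp, Equiv.symm_apply_apply]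
  have hne : ∀ z, z ≠ p → (sigmaPerm j).symm z ≠ i := fun z hz h =>
    hz ((sigmaPerm j).symm.injective (h.trans hpi.symm))
  have triv : ∀ z, z ≠ j → z ≠ p →
      HasSection (genPerm i * (genPerm j)⁻¹) z (Equiv.swap i p (Equiv.swap j k z)) 1 := by
    intro z hzj hzp
    have := (hasSection_genPerm_of_ne (hne z hzp)).mul (hinv z hzj)
    rw [hroot] at this
    simpa using this
  have s1 : HasSection (genPerm i * (genPerm j)⁻¹) i p 1 := by
    have := triv i hij hip
    rwa [Equiv.swap_apply_of_ne_of_ne hij hik, Equiv.swap_apply_left] at this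
  have s2 : HasSection (genPerm i * (genPerm j)⁻¹) p i (genPerm i) := by
    have := (hasSection_genPerm_self i).mul (hpi ▸ hinv p hpj)
    simpa using this
  have s3 : HasSection (genPerm i * (genPerm j)⁻¹) q q 1 := by
    have := triv q hjq.symm hpq.symm
    rwa [Equiv.swap_apply_of_ne_of_ne hjq.symm hkq.symm,
      Equiv.swap_apply_of_ne_of_ne hiq.symm hpq.symm] at this
  refine ⟨i, q, hiq, (genPerm i * (genPerm j)⁻¹) ^ 2,
    pow_mem (mul_mem (genPerm_mem i) (inv_mem (genPerm_mem j))) 2, fun z => ?_, ?_, ?_⟩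
  · obtain ⟨h, hh, hs⟩ := hgen z
    obtain ⟨h', hh', hs'⟩ := hgen (Equiv.swap i p (Equiv.swap j k z))
    rw [pow_two, (hs'.mul hs).apply_singleton (mul_mem hh' hh)]
    have hcomm : ∀ y, Equiv.swap j k (Equiv.swap i p y) = Equiv.swap i p (Equiv.swap j k y) := by
      intro y
      have h1 := Equiv.mul_swap_eq_swap_mul (Equiv.swap i p) j k
      rw [Equiv.swap_apply_of_ne_of_ne hij.symm hpj.symm,
        Equiv.swap_apply_of_ne_of_ne hik.symm hpk.symm] at h1
      exact (congrArg (fun f => f y) h1).symm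
    rw [hcomm, Equiv.swap_apply_self, Equiv.swap_apply_self]
  · rw [pow_two]
    simpa using s2.mul s1
  · exact (s3.pow 2).congr (one_pow 2)

/-- With four letters no letter is left over for q. Instead, for i = j + 1, the product a_{j-1}
a_{j+1} a_j⁻¹ is trivial on letters, and following the paths of j + 2 and j + 1 gives the two
sections. -/
theorem exists_base_four (i : Fin 4) : ∃ p q, p ≠ q ∧ ∃ w ∈ genGroup 4,
    FixesLetters w ∧ HasSection w p p (genPerm i) ∧ HasSection w q q 1 := by
  obtain ⟨j, rfl⟩ : ∃ j, i = j + 1 := ⟨i - 1, by simp⟩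
  have hroot : ∀ j z : Fin 4, sigmaPerm (j - 1) (sigmaPerm (j + 1) ((sigmaPerm j).symm z)) = z := by
    decide
  have h1 : ∀ j : Fin 4, (sigmaPerm j).symm (j + 2) = j + 1 ∧ j + 1 ≠ j ∧ j + 1 ≠ j - 1 ∧
      sigmaPerm (j - 1) (j + 1) = j + 2 := by decide
  have h2 : ∀ j : Fin 4, (sigmaPerm j).symm (j + 1) = j - 1 ∧ j - 1 ≠ j ∧ j - 1 ≠ j + 1 ∧
      sigmaPerm (j + 1) (j - 1) = j ∧ j ≠ j - 1 ∧ sigmaPerm (j - 1) j = j + 1 := by decide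
  have h3 : ∀ j : Fin 4, j + 2 ≠ j + 1 := by decide
  have hmem : genPerm (j - 1) * (genPerm (j + 1) * (genPerm j)⁻¹) ∈ genGroup 4 :=
    mul_mem (genPerm_mem _) (mul_mem (genPerm_mem _) (inv_mem (genPerm_mem _)))
  refine ⟨j + 2, j + 1, h3 j, _, hmem, fun z => ?_, ?_, ?_⟩
  · have e : ((genPerm j)⁻¹ : Equiv.Perm (List (Fin 4))) [z] = [(sigmaPerm j).symm z] := by
      rw [Equiv.Perm.inv_eq_iff_eq, genPerm_cons]
      simp [genPerm_nil]
    rw [Equiv.Perm.mul_apply, Equiv.Perm.mul_apply, e, genPerm_cons, genPerm_cons, hroot]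
    simp [genPerm_nil]
  · obtain ⟨e1, e2, e3, e4⟩ := h1 j
    have s1 : HasSection (genPerm j)⁻¹ (j + 2) (j + 1) 1 := by
      have := hasSection_genPerm_of_ne e2
      rw [← e1, Equiv.apply_symm_apply] at this
      simpa [e1] using this.inv
    have := (hasSection_genPerm_of_ne e3).mul ((hasSection_genPerm_self (j + 1)).mul s1)
    rw [e4] at this
    simpa using this
  · obtain ⟨e1, e2, e3, e4, e5, e6⟩ := h2 j
    have s1 : HasSection (genPerm j)⁻¹ (j + 1) (j - 1) 1 := by
      have := hasSection_genPerm_of_ne e2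
      rw [← e1, Equiv.apply_symm_apply] at this
      simpa [e1] using this.inv
    have s2 := hasSection_genPerm_of_ne e3
    rw [e4] at s2
    have s3 := hasSection_genPerm_of_ne e5
    rw [e6] at s3
    simpa using s3.mul (s2.mul s1)

theorem exists_base (hn : 4 ≤ n) (i : Fin n) : ∃ p q, p ≠ q ∧ ∃ w ∈ genGroup n,
    FixesLetters w ∧ HasSection w p p (genPerm i) ∧ HasSection w q q 1 := by
  rcases hn.eq_or_lt with rfl | h
  · exact exists_base_four i
  · exact exists_base_of_five_le h i

/-- Conjugation by an element taking the base pair to (p, q) moves the base element there, at the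
cost of conjugating its section by s. -/
theorem exists_base_conj (hn : 4 ≤ n) (i : Fin n) {p q : Fin n} (hpq : p ≠ q) :
    ∃ s ∈ genGroup n, ∃ w ∈ genGroup n, FixesLetters w ∧
      HasSection w p p (s * genPerm i * s⁻¹) ∧ HasSection w q q 1 := by
  obtain ⟨p', q', hpq', w, hw, hf, hp, hq⟩ := exists_base hn i
  obtain ⟨g, hg, ⟨s, hs, hgp⟩, ⟨t, -, hgq⟩⟩ := exists_hasSection_two (by omega) hpq' hpq
  refine ⟨s, hs, g * w * g⁻¹, mul_mem (mul_mem hg hw) (inv_mem hg), hf.conj hg,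
    (hgp.mul hp).mul hgp.inv, ?_⟩
  simpa using (hgq.mul hq).mul hgq.inv

theorem exists_fixesLetters_hasSection (hn : 4 ≤ n) (p : Fin n) {h : Equiv.Perm (List (Fin n))}
    (hh : h ∈ genGroup n) : ∃ w ∈ genGroup n, FixesLetters w ∧ HasSection w p p h := by
  induction hh using Subgroup.closure_induction with
  | mem h hh =>
    obtain ⟨i, rfl⟩ := hh
    obtain ⟨q, hq, -⟩ := exists_ne_ne (by omega) p p
    obtain ⟨s, hs, w, hw, hf, hwp, -⟩ := exists_base_conj hn i hq.symm
    obtain ⟨g, hg, hgs⟩ := exists_hasSection_self (by omega) p (inv_mem hs)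
    exact ⟨g * w * g⁻¹, mul_mem (mul_mem hg hw) (inv_mem hg), hf.conj hg,
      ((hgs.mul hwp).mul hgs.inv).congr (by group)⟩
  | one => exact ⟨1, one_mem _, FixesLetters.one, HasSection.one p⟩
  | mul a b _ _ ha hb =>
    obtain ⟨g, hg, hf, hs⟩ := ha
    obtain ⟨g', hg', hf', hs'⟩ := hb
    exact ⟨_, mul_mem hg hg', hf.mul hf', hs.mul hs'⟩
  | inv a _ ha =>
    obtain ⟨g, hg, hf, hs⟩ := ha
    exact ⟨_, inv_mem hg, hf.inv, hs.inv⟩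

/-- The sections at `p` of the elements which fix the first level and act trivially below `q` form
the whole group. -/
theorem exists_fixesLetters_hasSection_one (hn : 4 ≤ n) {p q : Fin n} (hpq : p ≠ q)
    {h : Equiv.Perm (List (Fin n))} (hh : h ∈ genGroup n) :
    ∃ w ∈ genGroup n, FixesLetters w ∧ HasSection w p p h ∧ HasSection w q q 1 := by
  induction hh using Subgroup.closure_induction with
  | mem h hh =>
    obtain ⟨i, rfl⟩ := hh
    obtain ⟨s, hs, w, hw, hf, hwp, hwq⟩ := exists_base_conj hn i hpq
    -- The conjugator that undoes s must also fix q, so that the trivial section stays at q; hence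
    -- it is taken in the first-level stabilizer.
    obtain ⟨g, hg, hgf, hgs⟩ := exists_fixesLetters_hasSection hn p (inv_mem hs)
    obtain ⟨u, -, hu⟩ := hgf.exists_hasSection hg q
    refine ⟨g * w * g⁻¹, mul_mem (mul_mem hg hw) (inv_mem hg), hf.conj hg,
      ((hgs.mul hwp).mul hgs.inv).congr (by group), ?_⟩
    simpa using (hu.mul hwq).mul hu.inv
  | one => exact ⟨1, one_mem _, FixesLetters.one, HasSection.one p, HasSection.one q⟩
  | mul a b _ _ ha hb =>
    obtain ⟨g, hg, hf, hs, ht⟩ := ha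
    obtain ⟨g', hg', hf', hs', ht'⟩ := hb
    exact ⟨_, mul_mem hg hg', hf.mul hf', hs.mul hs', ht.mul ht'⟩
  | inv a _ ha =>
    obtain ⟨g, hg, hf, hs, ht⟩ := ha
    exact ⟨_, inv_mem hg, hf.inv, hs.inv, by simpa using ht.inv⟩

end Stabilizer

/-! ### The lower central series and the branching subgroup -/

section Series

variable {n : ℕ}

/-- The lower central series of `genGroup n`, starting with the group itself. -/
def lowerSeries (n : ℕ) : ℕ → Subgroup (Equiv.Perm (List (Fin n)))
  | 0 => genGroup n
  | k + 1 => ⁅lowerSeries n k, genGroup n⁆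

theorem conj_mem_commutator {A : Type*} [Group A] {H K : Subgroup A} {g : A}
    (hH : ∀ x ∈ H, g * x * g⁻¹ ∈ H) (hK : ∀ x ∈ K, g * x * g⁻¹ ∈ K) :
    ∀ x ∈ ⁅H, K⁆, g * x * g⁻¹ ∈ ⁅H, K⁆ := by
  have h : ⁅H, K⁆ ≤ ⁅H, K⁆.comap (MulAut.conj g).toMonoidHom := by
    rw [Subgroup.commutator_le]
    intro a ha b hb
    rw [Subgroup.mem_comap, map_commutatorElement]
    exact Subgroup.commutator_mem_commutator (by simpa using hH a ha) (by simpa using hK b hb)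
  intro x hx
  simpa using h hx

theorem conj_mem_genGroup {g : Equiv.Perm (List (Fin n))} (hg : g ∈ genGroup n) :
    ∀ x ∈ genGroup n, g * x * g⁻¹ ∈ genGroup n :=
  fun _ hx => mul_mem (mul_mem hg hx) (inv_mem hg)

theorem conj_mem_lowerSeries {g : Equiv.Perm (List (Fin n))} (hg : g ∈ genGroup n) (k : ℕ) :
    ∀ x ∈ lowerSeries n k, g * x * g⁻¹ ∈ lowerSeries n k := by
  induction k with
  | zero => exact conj_mem_genGroup hg
  | succ k ih => exact conj_mem_commutator ih (conj_mem_genGroup hg)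

theorem lowerSeries_le (k : ℕ) : lowerSeries n k ≤ genGroup n := by
  induction k with
  | zero => exact le_rfl
  | succ k ih =>
    refine Subgroup.commutator_le.2 fun a ha b hb => ?_
    exact mul_mem (mul_mem (mul_mem (ih ha) hb) (inv_mem (ih ha))) (inv_mem hb)

theorem genPerm_pow_cons (i x : Fin n) (w : List (Fin n)) (k : ℕ) :
    (genPerm i ^ k) (x :: w) = (sigmaPerm i ^ k) x :: (if x = i then (genPerm i ^ k) w else w) := by
  by_cases h : x = i
  · subst h
    rw [(hasSection_genPerm_self x).pow k, if_pos rfl,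
      Equiv.Perm.pow_apply_eq_self_of_apply_eq_self (sigmaPerm_self x)]
  · rw [hasSection_genPerm_pow h, if_neg h, Equiv.Perm.one_apply]

theorem isOfFinOrder_genPerm (i : Fin n) : IsOfFinOrder (genPerm i) := by
  rw [isOfFinOrder_iff_pow_eq_one]
  refine ⟨orderOf (sigmaPerm i), orderOf_pos _, ?_⟩
  ext1 w
  induction w with
  | nil => exact apply_nil_of_mem (pow_mem (genPerm_mem i) _)
  | cons x w ih =>
    rw [genPerm_pow_cons, pow_orderOf_eq_one, ih]
    simp

theorem relIndex_lowerSeries_ne_zero (k : ℕ) : (lowerSeries n k).relIndex (genGroup n) ≠ 0 := by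
  induction k with
  | zero => simp [lowerSeries]
  | succ k ih =>
    refine relIndex_commutator_ne_zero (Set.finite_range _) ?_ (lowerSeries_le k)
      (fun g hg => conj_mem_lowerSeries hg k) ih
    rintro _ ⟨i, rfl⟩
    exact isOfFinOrder_genPerm i

/-- Each further letter of Q costs one commutator, that is, one step of the series. -/
theorem exists_lowerSeries_hasSection (hn : 4 ≤ n) (p : Fin n) (Q : Finset (Fin n)) (hp : p ∉ Q) :
    ∀ k ∈ lowerSeries n Q.card, ∃ g ∈ lowerSeries n Q.card, FixesLetters g ∧
      HasSection g p p k ∧ ∀ q ∈ Q, HasSection g q q 1 := by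
  induction Q using Finset.induction_on with
  | empty =>
    intro k hk
    obtain ⟨g, hg, hf, hs⟩ := exists_fixesLetters_hasSection hn p hk
    exact ⟨g, hg, hf, hs, by simp⟩
  | insert r Q hr ih =>
    rw [Finset.mem_insert, not_or] at hp
    rw [Finset.card_insert_of_notMem hr]
    intro k hk
    rw [lowerSeries, Subgroup.commutator_def] at hk
    induction hk using Subgroup.closure_induction with
    | mem k hk =>
      obtain ⟨a, ha, b, hb, rfl⟩ := hk
      obtain ⟨g, hg, hf, hs, hQ⟩ := ih hp.2 a ha
      obtain ⟨w, hw, hwf, hwp, hwr⟩ := exists_fixesLetters_hasSection_one hn hp.1 hb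
      -- The commutator is trivial at r because w is, and at the letters of Q because g is.
      refine ⟨⁅g, w⁆, Subgroup.commutator_mem_commutator hg hw,
        ((hf.mul hwf).mul hf.inv).mul hwf.inv, ((hs.mul hwp).mul hs.inv).mul hwp.inv, ?_⟩
      intro q hq
      rcases Finset.mem_insert.1 hq with rfl | hq
      · obtain ⟨u, -, hu⟩ := hf.exists_hasSection (lowerSeries_le _ hg) q
        simpa [commutatorElement_def] using ((hu.mul hwr).mul hu.inv).mul hwr.inv
      · obtain ⟨u, -, hu⟩ := hwf.exists_hasSection hw q
        simpa [commutatorElement_def] using (((hQ q hq).mul hu).mul (hQ q hq).inv).mul hu.inv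
    | one => exact ⟨1, one_mem _, FixesLetters.one, HasSection.one p, fun q _ => HasSection.one q⟩
    | mul a b _ _ ha hb =>
      obtain ⟨g, hg, hf, hs, ht⟩ := ha
      obtain ⟨g', hg', hf', hs', ht'⟩ := hb
      exact ⟨_, mul_mem hg hg', hf.mul hf', hs.mul hs', fun q hq => (ht q hq).mul (ht' q hq)⟩
    | inv a _ ha =>
      obtain ⟨g, hg, hf, hs, ht⟩ := ha
      exact ⟨_, inv_mem hg, hf.inv, hs.inv, fun q hq => by simpa using (ht q hq).inv⟩

/-- A term of the lower central series over which `genGroup n` is regular branch. -/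
def branchGroup (n : ℕ) : Subgroup (Equiv.Perm (List (Fin n))) := lowerSeries n (n - 1)

theorem actBelow_mem_branchGroup (hn : 4 ≤ n) (p : Fin n) {k : Equiv.Perm (List (Fin n))}
    (hk : k ∈ branchGroup n) : actBelow p k ∈ branchGroup n := by
  have hcard : (Finset.univ.erase p).card = n - 1 := by simp
  obtain ⟨g, hg, -, hs, hQ⟩ := exists_lowerSeries_hasSection hn p (Finset.univ.erase p) (by simp) k
    (hcard ▸ hk)
  rw [hcard] at hg
  have : actBelow p k = g := by
    refine eq_of_hasSection ?_ fun x => ?_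
    · rw [actBelow_nil, apply_nil_of_mem (lowerSeries_le _ hg)]
    · by_cases hx : x = p
      · subst hx
        exact ⟨x, k, hasSection_actBelow_self x k, hs⟩
      · exact ⟨x, 1, hasSection_actBelow_of_ne hx k, hQ x (by simp [hx])⟩
  rw [this]
  exact hg

theorem genPerm_mul_inv_apply_singleton (hn : 2 ≤ n) (i j z : Fin n) :
    (genPerm i * (genPerm j)⁻¹ : Equiv.Perm (List (Fin n))) [z] =
      [Equiv.swap i (fullCycle n i) (Equiv.swap j (fullCycle n j) z)] := by
  have e : ((genPerm j)⁻¹ : Equiv.Perm (List (Fin n))) [z] = [(sigmaPerm j).symm z] := by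
    rw [Equiv.Perm.inv_eq_iff_eq, genPerm_cons]
    simp [genPerm_nil]
  have hsj : (sigmaPerm j).symm z = (fullCycle n).symm (Equiv.swap j (fullCycle n j) z) := by
    rw [Equiv.symm_apply_eq, sigmaPerm_eq hn, Equiv.Perm.mul_apply]
    simp
  rw [Equiv.Perm.mul_apply, e, genPerm_cons, hsj, sigmaPerm_eq hn i, Equiv.Perm.mul_apply,
    Equiv.apply_symm_apply]
  simp [genPerm_nil]

/-- Every term of the lower central series acts on the first level by a double transposition on four
of the letters. -/
theorem exists_lowerSeries_apply (hn : 4 ≤ n) : ∃ z₀ z₁ z₂ z₃ : Fin n, z₀ ≠ z₁ ∧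
    ∀ k, ∃ g ∈ lowerSeries n k, g [z₀] = [z₁] ∧ g [z₁] = [z₀] ∧ g [z₂] = [z₃] ∧ g [z₃] = [z₂] := by
  let z₀ : Fin n := ⟨0, by omega⟩
  let z₁ : Fin n := ⟨1, by omega⟩
  let z₂ : Fin n := ⟨2, by omega⟩
  let z₃ : Fin n := ⟨3, by omega⟩
  have c0 : fullCycle n z₀ = z₁ := Fin.ext (by rw [fullCycle_val]; simp [z₀, z₁]; omega)
  have c1 : fullCycle n z₁ = z₂ := Fin.ext (by rw [fullCycle_val]; simp [z₁, z₂]; omega)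
  have c2 : fullCycle n z₂ = z₃ := Fin.ext (by rw [fullCycle_val]; simp [z₂, z₃]; omega)
  have h01 : z₀ ≠ z₁ := by simp [z₀, z₁]
  have h02 : z₀ ≠ z₂ := by simp [z₀, z₂]
  have h03 : z₀ ≠ z₃ := by simp [z₀, z₃]
  have h12 : z₁ ≠ z₂ := by simp [z₁, z₂]
  have h13 : z₁ ≠ z₃ := by simp [z₁, z₃]
  have h23 : z₂ ≠ z₃ := by simp [z₂, z₃]
  refine ⟨z₀, z₁, z₂, z₃, h01, ?_⟩
  obtain ⟨r, hr⟩ : ∃ r, r = genPerm z₀ * (genPerm z₁)⁻¹ := ⟨_, rfl⟩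
  have hrG : r ∈ genGroup n := hr ▸ mul_mem (genPerm_mem _) (inv_mem (genPerm_mem _))
  have r0 : r [z₀] = [z₁] := by
    rw [hr, genPerm_mul_inv_apply_singleton (by omega), c0, c1]
    simp [Equiv.swap_apply_of_ne_of_ne h01 h02]
  have r1 : r [z₁] = [z₂] := by
    rw [hr, genPerm_mul_inv_apply_singleton (by omega), c0, c1]
    simp [Equiv.swap_apply_of_ne_of_ne h02.symm h12.symm]
  have r2 : r [z₂] = [z₀] := by
    rw [hr, genPerm_mul_inv_apply_singleton (by omega), c0, c1]
    simp
  have i0 : r⁻¹ [z₁] = [z₀] := by rw [Equiv.Perm.inv_eq_iff_eq, r0]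
  have i1 : r⁻¹ [z₂] = [z₁] := by rw [Equiv.Perm.inv_eq_iff_eq, r1]
  have i2 : r⁻¹ [z₀] = [z₂] := by rw [Equiv.Perm.inv_eq_iff_eq, r2]
  have r3 : r [z₃] = [z₃] := by
    rw [hr, genPerm_mul_inv_apply_singleton (by omega), c0, c1]
    rw [Equiv.swap_apply_of_ne_of_ne h13.symm h23.symm,
      Equiv.swap_apply_of_ne_of_ne h03.symm h13.symm]
  have i3 : r⁻¹ [z₃] = [z₃] := by rw [Equiv.Perm.inv_eq_iff_eq, r3]
  intro k
  induction k with
  | zero =>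
    refine ⟨genPerm z₀ * (genPerm z₂)⁻¹, mul_mem (genPerm_mem _) (inv_mem (genPerm_mem _)), ?_⟩
    simp only [genPerm_mul_inv_apply_singleton (show 2 ≤ n by omega), c0, c2]
    simp [Equiv.swap_apply_of_ne_of_ne h02 h03, Equiv.swap_apply_of_ne_of_ne h12 h13,
      Equiv.swap_apply_of_ne_of_ne h02.symm h12.symm,
      Equiv.swap_apply_of_ne_of_ne h03.symm h13.symm]
  | succ k ih =>
    obtain ⟨g, hg, g0, g1, g2, g3⟩ := ih
    have j0 : g⁻¹ [z₁] = [z₀] := by rw [Equiv.Perm.inv_eq_iff_eq, g0]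
    have j1 : g⁻¹ [z₀] = [z₁] := by rw [Equiv.Perm.inv_eq_iff_eq, g1]
    have j2 : g⁻¹ [z₃] = [z₂] := by rw [Equiv.Perm.inv_eq_iff_eq, g2]
    have j3 : g⁻¹ [z₂] = [z₃] := by rw [Equiv.Perm.inv_eq_iff_eq, g3]
    -- Here r is a 3-cycle on z₀, z₁, z₂ fixing z₃. The commutator of g = (z₀ z₁)(z₂ z₃) with r is
    -- (z₀ z₂)(z₁ z₃), and conjugation by r restores the original double transposition.
    refine ⟨r * ⁅g, r⁆ * r⁻¹, conj_mem_lowerSeries hrG (k + 1) _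
      (Subgroup.commutator_mem_commutator hg hrG), ?_⟩
    simp only [commutatorElement_def, Equiv.Perm.mul_apply, r0, r1, r2, r3, i0, i1, i2, i3, g0, g1,
      g2, g3, j0, j1, j2, j3, and_self]

theorem exists_branchGroup_hasSection_ne (hn : 4 ≤ n) (p : Fin n) :
    ∃ k ∈ branchGroup n, ∃ q u, q ≠ p ∧ HasSection k q p u := by
  obtain ⟨z₀, z₁, _, _, h01, h⟩ := exists_lowerSeries_apply hn
  obtain ⟨k, hk, hk0, -⟩ := h (n - 1)
  obtain ⟨y, u, hu, hs⟩ := exists_hasSection (lowerSeries_le _ hk) z₀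
  have h1 := (hs.apply_singleton hu).symm.trans hk0
  obtain rfl : y = z₁ := by simpa using h1
  obtain ⟨g, hg, hgs⟩ := exists_hasSection_one (by omega) y p
  obtain ⟨q, v, -, hv⟩ := exists_hasSection hg z₀
  refine ⟨g * k * g⁻¹, conj_mem_lowerSeries hg _ _ hk, q, _, ?_, (hgs.mul hs).mul hv.inv⟩
  rintro rfl
  exact h01 (hv.inv.letter_unique hgs.inv)

/-- For k in K taking q to p, and s with section h⁻¹ at p and 1 at q, the commutator [k, s] lies in
K and has section h at p. -/
theorem exists_branchGroup_hasSection (hn : 4 ≤ n) (p : Fin n) {h : Equiv.Perm (List (Fin n))}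
    (hh : h ∈ genGroup n) : ∃ t ∈ branchGroup n, HasSection t p p h := by
  obtain ⟨k, hk, q, u, hq, hu⟩ := exists_branchGroup_hasSection_ne hn p
  obtain ⟨s, hs, -, hsp, hsq⟩ := exists_fixesLetters_hasSection_one hn hq.symm (inv_mem hh)
  refine ⟨k * (s * k⁻¹ * s⁻¹), mul_mem hk (conj_mem_lowerSeries hs _ _ (inv_mem hk)), ?_⟩
  simpa using hu.mul ((hsq.mul hu.inv).mul hsp.inv)

/-- If t in K has section h at p, then [k, h] placed below p equals the commutator of k placed below
p with t, both of which lie in K. -/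
theorem lowerSeries_le_comap_actBelow (hn : 4 ≤ n) (p : Fin n) :
    lowerSeries n (n - 1 + 1) ≤ ⁅branchGroup n, branchGroup n⁆.comap (actBelow p) := by
  refine Subgroup.commutator_le.2 fun k hk h hh => ?_
  obtain ⟨t, ht, hs⟩ := exists_branchGroup_hasSection hn p hh
  have h1 := Subgroup.commutator_mem_commutator (actBelow_mem_branchGroup hn p hk) ht
  rw [commutatorElement_def, mul_assoc, mul_assoc, ← mul_assoc t, ← map_inv,
    conj_actBelow (lowerSeries_le _ ht) hs, ← map_mul] at h1
  rw [Subgroup.mem_comap]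
  simpa [commutatorElement_def, mul_assoc] using h1

/-- An element which fixes the first level lies in a subgroup containing its sections. -/
theorem mem_of_forall_hasSection {N : Subgroup (Equiv.Perm (List (Fin n)))}
    {d : Equiv.Perm (List (Fin n))} (hd : d [] = []) (k : Fin n → Equiv.Perm (List (Fin n)))
    (hs : ∀ x, HasSection d x x (k x)) (hN : ∀ x, actBelow x (k x) ∈ N) : d ∈ N := by
  have key : ∀ Q : Finset (Fin n), ∃ e ∈ N, e [] = [] ∧
      ∀ x, HasSection e x x (if x ∈ Q then k x else 1) := by
    intro Q
    induction Q using Finset.induction_on with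
    | empty => exact ⟨1, one_mem _, rfl, fun x => by simpa using HasSection.one x⟩
    | insert q Q hq ih =>
      obtain ⟨e, he, hnil, hse⟩ := ih
      refine ⟨actBelow q (k q) * e, mul_mem (hN q) he, ?_, fun x => ?_⟩
      · rw [Equiv.Perm.mul_apply, hnil, actBelow_nil]
      · by_cases hx : x = q
        · subst hx
          simpa [hq] using (hasSection_actBelow_self x (k x)).mul (hse x)
        · simpa [hx] using (hasSection_actBelow_of_ne hx (k q)).mul (hse x)
  obtain ⟨e, he, hnil, hse⟩ := key Finset.univ
  have : d = e := eq_of_hasSection (hd.trans hnil.symm) fun x =>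
    ⟨x, k x, hs x, by simpa using hse x⟩
  rwa [this]

/-- The coset of an element modulo N is determined by its action on letters and the cosets of its n
sections: finitely many data. -/
theorem relIndex_ne_zero_of_comap_actBelow (N : Subgroup (Equiv.Perm (List (Fin n))))
    (h : ∀ x, (N.comap (actBelow x)).relIndex (genGroup n) ≠ 0) :
    N.relIndex (genGroup n) ≠ 0 := by
  choose y s hs hsec using fun (g : genGroup n) (x : Fin n) => exists_hasSection g.2 x
  have hfin : ∀ x, Finite (genGroup n ⧸ (N.comap (actBelow x)).subgroupOf (genGroup n)) :=
    fun x => Nat.finite_of_card_ne_zero (h x)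
  let c : genGroup n → ((x : Fin n) →
      Fin n × (genGroup n ⧸ (N.comap (actBelow x)).subgroupOf (genGroup n))) :=
    fun g x => (y g x, QuotientGroup.mk ⟨s g x, hs g x⟩)
  have hc : ∀ g g', c g = c g' → g⁻¹ * g' ∈ N.subgroupOf (genGroup n) := by
    intro g g' hgg
    have h1 : ∀ x, y g x = y g' x := fun x => congrArg Prod.fst (congrFun hgg x)
    have h2 : ∀ x, actBelow x ((s g x)⁻¹ * s g' x) ∈ N := fun x =>
      (QuotientGroup.eq.1 (congrArg Prod.snd (congrFun hgg x)) :)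
    rw [Subgroup.mem_subgroupOf]
    refine mem_of_forall_hasSection (apply_nil_of_mem (g⁻¹ * g').2)
      (fun x => (s g x)⁻¹ * s g' x) (fun x => ?_) h2
    have := hsec g x
    rw [h1] at this
    exact this.inv.mul (hsec g' x)
  have : Finite (genGroup n ⧸ N.subgroupOf (genGroup n)) := by
    refine Finite.of_injective (fun q => c q.out) fun q q' hqq => ?_
    have := QuotientGroup.eq.2 (hc _ _ hqq)
    simpa using this
  exact Subgroup.index_ne_zero_of_finite

theorem relIndex_ne_zero_of_le {A : Type*} [Group A] {H K L : Subgroup A} (h : H ≤ K)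
    (hH : H.relIndex L ≠ 0) : K.relIndex L ≠ 0 := fun h0 =>
  hH (Nat.eq_zero_of_zero_dvd (h0 ▸ Subgroup.relIndex_dvd_of_le_left L h))

theorem relIndex_commutator_branchGroup_ne_zero (hn : 4 ≤ n) :
    ⁅branchGroup n, branchGroup n⁆.relIndex (genGroup n) ≠ 0 :=
  relIndex_ne_zero_of_comap_actBelow _ fun x =>
    relIndex_ne_zero_of_le (lowerSeries_le_comap_actBelow hn x) (relIndex_lowerSeries_ne_zero _)

end Series

/-! ### Nontrivial normal subgroups have finite index -/

section Normal

variable {n : ℕ}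

/-- The permutation which acts by `g` on the words starting with the word `v`, and fixes the other
words. -/
def actBelowWord : List (Fin n) → Equiv.Perm (List (Fin n)) →* Equiv.Perm (List (Fin n))
  | [] => MonoidHom.id _
  | x :: v => (actBelow x).comp (actBelowWord v)

theorem actBelowWord_cons (x : Fin n) (v : List (Fin n)) (g : Equiv.Perm (List (Fin n))) :
    actBelowWord (x :: v) g = actBelow x (actBelowWord v g) := rfl

theorem actBelowWord_mem_branchGroup (hn : 4 ≤ n) (v : List (Fin n))
    {k : Equiv.Perm (List (Fin n))} (hk : k ∈ branchGroup n) :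
    actBelowWord v k ∈ branchGroup n := by
  induction v with
  | nil => exact hk
  | cons x v ih => exact actBelow_mem_branchGroup hn x ih

theorem exists_conj_actBelowWord (v : List (Fin n)) {g : Equiv.Perm (List (Fin n))}
    (hg : g ∈ genGroup n) : (g v).length = v.length ∧ ∃ h ∈ genGroup n, ∀ k,
      g * actBelowWord v k * g⁻¹ = actBelowWord (g v) (h * k * h⁻¹) := by
  induction v generalizing g with
  | nil =>
    rw [apply_nil_of_mem hg]
    exact ⟨rfl, g, hg, fun k => rfl⟩
  | cons x v ih =>
    obtain ⟨y, s, hs, hsec⟩ := exists_hasSection hg x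
    obtain ⟨hlen, h, hh, hconj⟩ := ih hs
    rw [hsec]
    refine ⟨by simp [hlen], h, hh, fun k => ?_⟩
    rw [actBelowWord_cons, conj_actBelow hg hsec, hconj, actBelowWord_cons]

theorem commute_actBelow {x y : Fin n} (h : x ≠ y) (a b : Equiv.Perm (List (Fin n))) :
    Commute (actBelow x a) (actBelow y b) := by
  refine eq_of_hasSection rfl fun z => ?_
  by_cases hx : z = x
  · subst hx
    exact ⟨z, a, by simpa using (hasSection_actBelow_self z a).mul (hasSection_actBelow_of_ne h b),
      by simpa using (hasSection_actBelow_of_ne h b).mul (hasSection_actBelow_self z a)⟩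
  · have h1 := hasSection_actBelow_of_ne hx a
    by_cases hy : z = y
    · subst hy
      exact ⟨z, b, by simpa using h1.mul (hasSection_actBelow_self z b),
        by simpa using (hasSection_actBelow_self z b).mul h1⟩
    · have h2 := hasSection_actBelow_of_ne hy b
      exact ⟨z, 1, by simpa using h1.mul h2, by simpa using h2.mul h1⟩

theorem commute_actBelowWord {v v' : List (Fin n)} (hlen : v.length = v'.length) (h : v ≠ v')
    (a b : Equiv.Perm (List (Fin n))) : Commute (actBelowWord v a) (actBelowWord v' b) := by
  induction v generalizing v' with
  | nil => exact absurd (List.length_eq_zero_iff.1 hlen.symm).symm h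
  | cons x v ih =>
    rcases v' with _ | ⟨y, v'⟩
    · simp at hlen
    · rw [actBelowWord_cons, actBelowWord_cons]
      by_cases hxy : x = y
      · subst hxy
        exact (ih (by simpa using hlen) (fun e => h (by rw [e]))).map (actBelow x)
      · exact commute_actBelow hxy _ _

/-- The group acts transitively on each level, by elements with trivial sections. -/
theorem exists_conj_actBelowWord_eq (hn : 3 ≤ n) (v u : List (Fin n)) (hlen : v.length = u.length) :
    ∃ g ∈ genGroup n, ∀ k, g * actBelowWord v k * g⁻¹ = actBelowWord u k := by
  induction v generalizing u with
  | nil =>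
    obtain rfl := List.length_eq_zero_iff.1 hlen.symm
    exact ⟨1, one_mem _, fun k => by simp⟩
  | cons x v ih =>
    rcases u with _ | ⟨y, u⟩
    · simp at hlen
    · obtain ⟨g, hg, hconj⟩ := ih u (by simpa using hlen)
      obtain ⟨g', hg', hs⟩ := exists_hasSection_self hn x hg
      obtain ⟨t, ht, hts⟩ := exists_hasSection_one hn x y
      refine ⟨t * g', mul_mem ht hg', fun k => ?_⟩
      rw [actBelowWord_cons, actBelowWord_cons, mul_inv_rev]
      calc t * g' * actBelow x (actBelowWord v k) * (g'⁻¹ * t⁻¹)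
          = t * (g' * actBelow x (actBelowWord v k) * g'⁻¹) * t⁻¹ := by group
        _ = _ := by rw [conj_actBelow hg' hs, hconj, conj_actBelow ht hts]; simp

theorem commutatorElement_mul_of_commute {A : Type*} [Group A] {b x y : A} (hx : Commute b x)
    (hy : Commute b y) : ⁅b * x, y⁆ = ⁅x, y⁆ := by
  have h : Commute b (x * y * x⁻¹) := (hx.mul_right hy).mul_right hx.inv_right
  rw [commutatorElement_def, commutatorElement_def, mul_inv_rev]
  calc b * x * y * (x⁻¹ * b⁻¹) * y⁻¹ = (b * (x * y * x⁻¹)) * b⁻¹ * y⁻¹ := by group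
    _ = x * y * x⁻¹ * y⁻¹ := by rw [h.eq]; group

theorem relIndex_ne_zero_of_actBelowWord (hn : 4 ≤ n) (m : ℕ)
    (N : Subgroup (Equiv.Perm (List (Fin n))))
    (h : ∀ u : List (Fin n), u.length = m →
      ⁅branchGroup n, branchGroup n⁆ ≤ N.comap (actBelowWord u)) :
    N.relIndex (genGroup n) ≠ 0 := by
  induction m generalizing N with
  | zero => exact relIndex_ne_zero_of_le (h [] rfl) (relIndex_commutator_branchGroup_ne_zero hn)
  | succ m ih =>
    refine relIndex_ne_zero_of_comap_actBelow N fun x => ih _ fun u hu => ?_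
    rw [Subgroup.comap_comap]
    exact h (x :: u) (by simp [hu])

/-- A nontrivial subgroup normalized by `genGroup n` has finite index. -/
theorem relIndex_ne_zero_of_normalized (hn : 4 ≤ n) (N : Subgroup (Equiv.Perm (List (Fin n))))
    (hN : ∀ g ∈ genGroup n, ∀ x ∈ N, g * x * g⁻¹ ∈ N) {g : Equiv.Perm (List (Fin n))}
    (hg : g ∈ genGroup n) (hgN : g ∈ N) (hg1 : g ≠ 1) : N.relIndex (genGroup n) ≠ 0 := by
  obtain ⟨v, hv⟩ : ∃ v, g v ≠ v := by
    by_contra! h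
    exact hg1 (Equiv.ext h)
  obtain ⟨hlen, h, hh, hconj⟩ := exists_conj_actBelowWord v hg
  have key : ⁅branchGroup n, branchGroup n⁆ ≤ N.comap (actBelowWord v) := by
    refine Subgroup.commutator_le.2 fun a ha b hb => ?_
    rw [Subgroup.mem_comap]
    have haG := lowerSeries_le _ (actBelowWord_mem_branchGroup hn v ha)
    have hbG := lowerSeries_le _ (actBelowWord_mem_branchGroup hn v hb)
    -- The element [g, a⁻¹], with a placed below v, is a factor below g v times a below v. Commuting
    -- with b below v removes the first factor and leaves [a, b] below v.
    have h1 : g * actBelowWord v a⁻¹ * g⁻¹ * actBelowWord v a ∈ N := by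
      have := mul_mem hgN (hN _ (inv_mem haG) _ (inv_mem hgN))
      simpa [mul_assoc] using this
    rw [hconj] at h1
    have h2 : ⁅actBelowWord (g v) (h * a⁻¹ * h⁻¹) * actBelowWord v a, actBelowWord v b⁆ ∈ N := by
      have := mul_mem h1 (hN _ hbG _ (inv_mem h1))
      simpa only [commutatorElement_def, mul_assoc] using this
    rw [commutatorElement_mul_of_commute (commute_actBelowWord hlen hv _ _)
      (commute_actBelowWord hlen hv _ _), ← map_commutatorElement] at h2
    exact h2
  refine relIndex_ne_zero_of_actBelowWord hn v.length N fun u hu => ?_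
  obtain ⟨t, ht, htu⟩ := exists_conj_actBelowWord_eq (by omega) v u hu.symm
  intro k hk
  rw [Subgroup.mem_comap, ← htu]
  exact hN t ht _ (key hk)

/-- Lifting each h to an element fixing p with section h is injective. On a finite group it would be
onto, yet some elements move p. -/
theorem infinite_genGroup (hn : 3 ≤ n) : Infinite (genGroup n) := by
  by_contra hfin
  rw [not_infinite_iff_finite] at hfin
  let p : Fin n := ⟨0, by omega⟩
  obtain ⟨q, hq, -⟩ := exists_ne_ne hn p p
  choose r hr hs using fun h : genGroup n => exists_hasSection_self hn p h.2
  let f : genGroup n → genGroup n := fun h => ⟨r h, hr h⟩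
  have hinj : Function.Injective f := by
    intro h h' e
    have e' : r h = r h' := congrArg Subtype.val e
    refine Subtype.ext (Equiv.ext fun w => ?_)
    have h1 := hs h w
    rw [e', hs h' w] at h1
    exact (List.cons.inj h1).2.symm
  obtain ⟨t, ht, hts⟩ := exists_hasSection_one hn p q
  obtain ⟨h, hh⟩ := Finite.surjective_of_injective hinj ⟨t, ht⟩
  have h1 : r h = t := congrArg Subtype.val hh
  exact hq (hts.letter_unique (h1 ▸ hs h))

theorem isJustInfinite_genGroup (hn : 4 ≤ n) : IsJustInfinite (genGroup n) := by
  refine ⟨infinite_genGroup (by omega), fun N hN hne => ?_⟩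
  obtain ⟨⟨g, hgN⟩, hg1'⟩ := Subgroup.ne_bot_iff_exists_ne_one.1 hne
  have hg1 : g ≠ 1 := fun e => hg1' (Subtype.ext e)
  have h := relIndex_ne_zero_of_normalized hn (N.map (genGroup n).subtype) (by
    rintro g hg _ ⟨x, hx, rfl⟩
    exact ⟨⟨g, hg⟩ * x * ⟨g, hg⟩⁻¹, hN.conj_mem x hx ⟨g, hg⟩, rfl⟩)
    (g : genGroup n).2 ⟨_, hgN, rfl⟩ (fun e => hg1 (Subtype.ext e))
  rw [Subgroup.relIndex, Subgroup.subgroupOf, Subgroup.comap_map_eq_self_of_injective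
    Subtype.val_injective] at h
  exact Nat.finite_of_card_ne_zero h

/-! ### Transfer to the group of tree automorphisms -/

theorem map_subtype_hanoiGroup (n : ℕ) :
    (hanoiGroup n).map (treeAut n).subtype = genGroup n := by
  rw [hanoiGroup, MonoidHom.map_closure, ← Set.range_comp]
  rfl

/-- The group of tree automorphisms is isomorphic to the corresponding group of permutations. -/
noncomputable def hanoiGroupEquiv (n : ℕ) : hanoiGroup n ≃* genGroup n :=
  ((hanoiGroup n).equivMapOfInjective (treeAut n).subtype Subtype.val_injective).trans
    (MulEquiv.subgroupCongr (map_subtype_hanoiGroup n))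

end Normal

theorem theorem3p13 (n : ℕ) (hn : 3 ≤ n) :
    IsJustInfinite (hanoiGroup n) ↔ n ≠ 3 := by
  constructor
  · rintro h rfl
    exact not_isJustInfinite_genGroup_three (h.of_mulEquiv (hanoiGroupEquiv 3))
  · intro h
    exact (isJustInfinite_genGroup (by omega)).of_mulEquiv (hanoiGroupEquiv n).symm
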